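/- Let $\mathcal C$ be a locally finite category (all hom-sets finite). Subcategories are not assumed full. A subcategory $\mathcal G$ is finite if it has finitely many objects and morphisms, and dense if every object $X$ of $\mathcal C$ is, canonically, the colimit of its standard diagram $\mathcal G\downarrow X\to\mathcal G$ (all ways of mapping objects of $\mathcal G$ into $X$). The image of a subcategory under a functor is the subcategory generated by the images of its objects and morphisms. Let $U:\mathcal C\to\mathcal C$ be a categorical Gandy machine: $\mathcal C$ is locally finite and has a finite dense subcategory; the functor $\mathcal C\downarrow\mathcal C\to\mathcal C\downarrow U$, $(X\xrightarrow{f}Y)\mapsto(UX\xrightarrow{Uf}UY)$, has a left adjoint $F$, with unit $\eta$; and for every subcategory $\mathcal S$ of $\mathcal C\downarrow U$ whose image $\operatorname{dom}[\mathcal S]$ is finite, $(\operatorname{dom}\circ F)[\mathcal S]$ is finite. Let $\mathcal G$ be a finite dense subcategory of $\mathcal C$, and let objects of $\mathcal C$ be represented by their standard diagrams in $\mathcal G$. Then $U$ is computable, in the following sense. 1. The category $\mathcal K=\operatorname{dom}(F(\mathcal G\downarrow U))$, which does not depend on any input $X$, is finite. So is the category $\mathcal R$ whose objects are the triples $(A,N,e)$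 with $A\in\mathcal G$, $N=\operatorname{dom}(Fp)\in\mathcal K$ and $e=\operatorname{dom}(\eta_p):A\to UN$ for some $p:A\to UZ$ in $\mathcal G\downarrow U$, and whose morphisms $(A,N,e)\to(A',N',e')$ are the pairs $(b:A\to A'\text{ in }\mathcal G,\ k:N\to N'\text{ in }\mathcal K)$ with $Uk\circ e=e'\circ b$. 2. For every object $X$ of $\mathcal C$, let $\mathcal T_X$ be the category whose objects are the pairs of an object $(A,N,e)$ of $\mathcal R$ and a morphism $h:N\to X$, and whose morphisms are the morphisms $(b,k)$ of $\mathcal R$ for which $h'\circ k=h$ (commuting triangles with apex $X$). Then $\mathcal T_X$ is finite, and $UX$ is the colimit of the finite diagram $\mathcal T_X\to\mathcal G\subseteq\mathcal C$, $(A,N,e,h)\mapsto A$, with legs $Uh\circ e:A\to UX$. 3. Number the objects and the morphisms of $\mathcal G$, in any way, by natural numbers, and encode a finite diagram in $\mathcal G$ by the list of its vertices and the list of its edges, labelled by these numbers. Then every object $X$ is the colimit of its standard diagram, which has a code, and there are computable (recursive) functions $f,g$, independent of $X$, such that for every object $X$ and every code $c$ of the standard diagram of $X$, $f(c)$ is a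 code of the diagram $\mathcal T_X\to\mathcal G$ of part 2, and $g(c)$ is a code of the standard diagram of $UX$. -/

import Mathlib

open CategoryTheory CategoryTheory.Limits

universe v u v' u' w w'

namespace Gandy

/-- A (not necessarily full) subcategory of `C`: a class of objects together with a class of
morphisms between them, containing the identities and closed under composition. -/
structure Subcat (C : Type u) [Category.{v} C] where
  obj : Set C
  hom : ∀ X Y : C, Set (X ⟶ Y)
  source_mem : ∀ {X Y : C} {f : X ⟶ Y}, f ∈ hom X Y → X ∈ obj
  target_mem : ∀ {X Y : C} {f : X ⟶ Y}, f ∈ hom X Y → Y ∈ obj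
  id_mem : ∀ {X : C}, X ∈ obj → 𝟙 X ∈ hom X X
  comp_mem : ∀ {X Y Z : C} {f : X ⟶ Y} {g : Y ⟶ Z},
    f ∈ hom X Y → g ∈ hom Y Z → f ≫ g ∈ hom X Z

namespace Subcat

section Basic

variable {C : Type u} [Category.{v} C]

/-- A subcategory is finite if it has finitely many objects and morphisms. -/
structure IsFinite (S : Subcat C) : Prop where
  obj_finite : S.obj.Finite
  hom_finite : ∀ X Y : C, (S.hom X Y).Finite

/-- The objects of a subcategory, as a category in its own right. -/
structure Carrier (S : Subcat C) where
  val : C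
  mem : val ∈ S.obj

instance (S : Subcat C) : Category.{v} S.Carrier where
  Hom A B := {f : A.val ⟶ B.val // f ∈ S.hom A.val B.val}
  id A := ⟨𝟙 A.val, S.id_mem A.mem⟩
  comp f g := ⟨f.1 ≫ g.1, S.comp_mem f.2 g.2⟩

/-- The inclusion functor of a subcategory. -/
def incl (S : Subcat C) : S.Carrier ⥤ C where
  obj A := A.val
  map f := f.1

variable {D : Type u'} [Category.{v'} D]

/-- The morphisms generated under composition by the images of the morphisms of `S`. -/
inductive ImageHom (S : Subcat C) (F : C ⥤ D) : ∀ X Y : D, (X ⟶ Y) → Prop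
  | map {A B : C} (f : A ⟶ B) (hf : f ∈ S.hom A B) :
      ImageHom S F (F.obj A) (F.obj B) (F.map f)
  | comp {X Y Z : D} (f : X ⟶ Y) (g : Y ⟶ Z) :
      ImageHom S F X Y f → ImageHom S F Y Z g → ImageHom S F X Z (f ≫ g)

theorem ImageHom.mem {S : Subcat C} {F : C ⥤ D} {X Y : D} {f : X ⟶ Y}
    (h : ImageHom S F X Y f) : X ∈ F.obj '' S.obj ∧ Y ∈ F.obj '' S.obj := by
  induction h with
  | map f hf => exact ⟨⟨_, S.source_mem hf, rfl⟩, ⟨_, S.target_mem hf, rfl⟩⟩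
  | comp f g _ _ ihf ihg => exact ⟨ihf.1, ihg.2⟩

/-- The image `F[S]` of a subcategory `S` of `C` under a functor `F : C ⥤ D`. -/
def image (S : Subcat C) (F : C ⥤ D) : Subcat D where
  obj := F.obj '' S.obj
  hom X Y := {f | ImageHom S F X Y f}
  source_mem h := h.mem.1
  target_mem h := h.mem.2
  id_mem := by
    rintro _ ⟨A, hA, rfl⟩
    have h := ImageHom.map (S := S) (F := F) (𝟙 A) (S.id_mem hA)
    rwa [F.map_id] at h
  comp_mem hf hg := ImageHom.comp _ _ hf hg

/-- For a subcategory `G` of `C` and `U : D ⥤ C`, the comma category `G ↓ U`, as a subcategory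
of `C ↓ U`. -/
def overComma (G : Subcat C) (U : D ⥤ C) : Subcat (Comma (𝟭 C) U) where
  obj := {p | p.left ∈ G.obj}
  hom p q := {m | m.left ∈ G.hom p.left q.left}
  source_mem h := G.source_mem h
  target_mem h := G.target_mem h
  id_mem h := G.id_mem h
  comp_mem hf hg := G.comp_mem hf hg

end Basic

end Subcat

section Machine

variable {C : Type u} [Category.{v} C]

/-- The functor `C ↓ C ⥤ C ↓ U` induced by `U`, sending `f : X ⟶ Y` to `(U X, U f, Y)`. -/
def commaLift (U : C ⥤ C) : Comma (𝟭 C) (𝟭 C) ⥤ Comma (𝟭 C) U where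
  obj f :=
    { left := U.obj f.left
      right := f.right
      hom := U.map f.hom }
  map m :=
    { left := U.map m.left
      right := m.right
      w := by
        have h := m.w
        simp only [Functor.id_map] at h ⊢
        rw [← U.map_comp, ← U.map_comp, h] }

/-- `U` is a categorical Gandy machine, with chosen left adjoint `F` of the functor
`C ↓ C ⥤ C ↓ U`. -/
structure CategoricalGandyMachine (U : C ⥤ C) where
  locallyFinite : ∀ X Y : C, Finite (X ⟶ Y)
  exists_finite_dense : ∃ G : Subcat C, G.IsFinite ∧ G.incl.IsDense
  F : Comma (𝟭 C) U ⥤ Comma (𝟭 C) (𝟭 C)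
  adj : F ⊣ commaLift U
  finite_image : ∀ S : Subcat (Comma (𝟭 C) U),
    (S.image (Comma.fst (𝟭 C) U)).IsFinite →
      (S.image (F ⋙ Comma.fst (𝟭 C) (𝟭 C))).IsFinite

namespace CategoricalGandyMachine

variable {U : C ⥤ C} (M : CategoricalGandyMachine U) (G : Subcat C)

/-- The category `dom(F(G ↓ U))` of causal neighbourhoods of parts with shape in `G`. -/
def neighbourhoods : Subcat C :=
  (G.overComma U).image (M.F ⋙ Comma.fst (𝟭 C) (𝟭 C))

/-- `e : A ⟶ U N` is the way in which the shape `A` occurs in the update of `N = dom (F p)`, for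
the minimal causal neighbourhood `F p` of some `p : A ⟶ U Z`; that is, `e` is the domain
component of the unit of the adjunction at `p`. -/
inductive IsCause (M : CategoricalGandyMachine U) : ∀ A N : C, (A ⟶ U.obj N) → Prop
  | mk (p : Comma (𝟭 C) U) :
      IsCause M p.left (M.F.obj p).left (M.adj.unit.app p).left

/-- The table of the machine: shapes `A` in `G`, with a causal neighbourhood `N` and the occurrence
`A ⟶ U N` of `A` in its update. No input object is involved. -/
structure Rule where
  shape : G.Carrier
  nbhd : C
  occ : G.incl.obj shape ⟶ U.obj nbhd
  isCause : M.IsCause (G.incl.obj shape) nbhd occ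

variable {M G} in
/-- A morphism of rules: a morphism of `G` between shapes and a morphism of the category of
neighbourhoods, compatible with the occurrences. -/
@[ext]
structure Rule.Hom (P Q : M.Rule G) where
  shape : P.shape ⟶ Q.shape
  nbhd : P.nbhd ⟶ Q.nbhd
  nbhd_mem : nbhd ∈ (M.neighbourhoods G).hom P.nbhd Q.nbhd
  w : P.occ ≫ U.map nbhd = G.incl.map shape ≫ Q.occ

variable {M G} in
theorem Rule.nbhd_mem (P : M.Rule G) : P.nbhd ∈ (M.neighbourhoods G).obj := by
  have key : ∀ (A N : C) (e : A ⟶ U.obj N), M.IsCause A N e → A ∈ G.obj →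
      N ∈ (M.neighbourhoods G).obj := by
    intro A N e h hA
    cases h with
    | mk p => exact ⟨p, hA, rfl⟩
  exact key _ _ _ P.isCause P.shape.mem

instance : Category (M.Rule G) where
  Hom P Q := Rule.Hom P Q
  id P :=
    { shape := 𝟙 P.shape
      nbhd := 𝟙 P.nbhd
      nbhd_mem := (M.neighbourhoods G).id_mem P.nbhd_mem
      w := by rw [U.map_id, G.incl.map_id, Category.comp_id]; exact (Category.id_comp _).symm }
  comp f g :=
    { shape := f.shape ≫ g.shape
      nbhd := f.nbhd ≫ g.nbhd
      nbhd_mem := (M.neighbourhoods G).comp_mem f.nbhd_mem g.nbhd_mem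
      w := by
        rw [U.map_comp, ← Category.assoc, f.w, Category.assoc, g.w, ← Category.assoc,
          ← Functor.map_comp] }
  id_comp f := Rule.Hom.ext (Category.id_comp f.shape) (Category.id_comp f.nbhd)
  comp_id f := Rule.Hom.ext (Category.comp_id f.shape) (Category.comp_id f.nbhd)
  assoc f g h := Rule.Hom.ext (Category.assoc f.shape g.shape h.shape)
    (Category.assoc f.nbhd g.nbhd h.nbhd)

/-- The functor sending a rule to its shape. -/
def shapeFunctor : M.Rule G ⥤ G.Carrier where
  obj P := P.shape
  map f := f.shape

/-- The functor sending a rule to its causal neighbourhood. -/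
def nbhdFunctor : M.Rule G ⥤ C where
  obj P := P.nbhd
  map f := f.nbhd

/-- The index category of the diagram for `U X`: its objects are the rules `P` with a morphism
`P.nbhd ⟶ X`, its morphisms are the morphisms of rules whose neighbourhood component forms a
commuting triangle with apex `X`. -/
abbrev Triangles (X : C) := CostructuredArrow (M.nbhdFunctor G) X

/-- The diagram in `G` used to evaluate `U` at `X`. -/
def diagram (X : C) : M.Triangles G X ⥤ G.Carrier :=
  CostructuredArrow.proj (M.nbhdFunctor G) X ⋙ M.shapeFunctor G

/-- The occurrences `A ⟶ U N` of the shapes of rules in the updates of their neighbourhoods. -/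
def occTrans : M.shapeFunctor G ⋙ G.incl ⟶ M.nbhdFunctor G ⋙ U where
  app P := P.occ
  naturality _ _ m := (Rule.Hom.w m).symm

/-- The cocone on that diagram with apex `U X`; the leg at `A ⟶ U N`, `h : N ⟶ X` is the composite
`A ⟶ U N ⟶ U X`. -/
def cocone (X : C) : Cocone (M.diagram G X ⋙ G.incl) where
  pt := U.obj X
  ι :=
    { app := fun T => (M.occTrans G).app T.left ≫ U.map T.hom
      naturality := by
        intro S T m
        have h1 : (M.nbhdFunctor G).map m.left ≫ T.hom = S.hom := CostructuredArrow.w m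
        have h2 := (M.occTrans G).naturality m.left
        change (M.shapeFunctor G ⋙ G.incl).map m.left ≫
            ((M.occTrans G).app T.left ≫ U.map T.hom) =
          ((M.occTrans G).app S.left ≫ U.map S.hom) ≫ 𝟙 (U.obj X)
        rw [Category.comp_id, ← Category.assoc, h2, Category.assoc, Functor.comp_map,
          ← U.map_comp, h1] }

end CategoricalGandyMachine

end Machine

section Coding

variable {C : Type u} [Category.{v} C]

/-- A numbering of the objects and morphisms of a subcategory by natural numbers. -/
structure Numbering (G : Subcat C) where
  obj : G.Carrier → ℕ
  obj_injective : Function.Injective obj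
  hom : ∀ {A B : G.Carrier}, (A ⟶ B) → ℕ
  hom_injective : ∀ {A B : G.Carrier}, Function.Injective (hom : (A ⟶ B) → ℕ)

/-- A finite diagram as a finite piece of data: the list of the labels of its vertices, and the list
of its edges, each given by source vertex, target vertex and label. -/
abbrev DiagramCode := List ℕ × List (ℕ × ℕ × ℕ)

/-- `c` is a code of the finite diagram `D : J ⥤ G`: its vertices are the objects of `J`, listed
without repetition and labelled by their values in `G`, and its edges are labelled by the values in
`G` of the morphisms of `J`. -/
def IsCode {G : Subcat C} (ν : Numbering G) {J : Type w} [Category.{w'} J] (D : J ⥤ G.Carrier)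
    (c : DiagramCode) : Prop :=
  ∃ x : Fin c.1.length ≃ J,
    (∀ i, c.1.get i = ν.obj (D.obj (x i))) ∧
    ∀ s t g : ℕ, (s, t, g) ∈ c.2 ↔
      ∃ (i j : Fin c.1.length) (φ : x i ⟶ x j),
        i.val = s ∧ j.val = t ∧ ν.hom (D.map φ) = g

/-- The standard diagram in `G` of an object `X`: all ways of mapping objects of `G` into `X`. -/
abbrev standardDiagram (G : Subcat C) (X : C) : CostructuredArrow G.incl X ⥤ G.Carrier :=
  CostructuredArrow.proj G.incl X

/-- The canonical cocone on the standard diagram of `X`, with apex `X`. -/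
def standardCocone (G : Subcat C) (X : C) : Cocone (standardDiagram G X ⋙ G.incl) where
  pt := X
  ι :=
    { app := fun T => T.hom
      naturality := by
        intro S T m
        exact (CostructuredArrow.w m).trans (Category.comp_id _).symm }

end Coding

end Gandy

namespace Gandy

/-! For `a : A ⟶ U X` the adjunction gives a minimal causal neighbourhood: an object `N` with `A ⟶ U
N` and `N ⟶ X` composing to `a`, through which every other factorization of `a` receives a morphism
(`exists_factor`). The image of `G ↓ U` under the domain functor lies in `G`, so the finiteness
axiom leaves only finitely many such `N` for shapes in `G`.

By density `U X` is the colimit of its elements `A ⟶ U X` with `A` in `G`. Sending an element to its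
minimal triangle turns a cocone on the triangles into one on these elements. No information is lost,
because a zigzag over the identity of the shape joins each triangle to the minimal triangle of its
element (`leg_eq_leg_causalTriangle`). Hence the triangles have the same colimit
(`isColimit_cocone`).

For computability, density identifies morphisms `N ⟶ X` with label-preserving graph homomorphisms
between codes of standard diagrams (`encode_injective`, `exists_encode_eq`), and these can be listed
by bounded search. Composition becomes list lookup, so all relations between triangles are decided
by finite tables that do not depend on `X` (`exists_table`). The triangles are then listed directly.
The elements of `U X` are triangles modulo having the same element, which is witnessed by a single
minimal triangle (`exists_initial_triangle`). All these operations are primitive recursive. -/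

/-! ### Finiteness and density preliminaries. -/

theorem Subcat.mem_hom_of_imageHom_fst {C : Type u} [Category.{v} C] {U : C ⥤ C} {G : Subcat C}
    {X Y : C} {f : X ⟶ Y} (h : Subcat.ImageHom (G.overComma U) (Comma.fst (𝟭 C) U) X Y f) :
    f ∈ G.hom X Y := by
  induction h with
  | map f hf => exact hf
  | comp f g _ _ ihf ihg => exact G.comp_mem ihf ihg

/-- `G ↓ U` itself may be infinite, but only its domains matter for the finiteness axiom of the
machine, and these stay in `G`. -/
theorem Subcat.IsFinite.image_overComma_fst {C : Type u} [Category.{v} C] {G : Subcat C}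
    (hG : G.IsFinite) (U : C ⥤ C) : ((G.overComma U).image (Comma.fst (𝟭 C) U)).IsFinite where
  obj_finite := hG.obj_finite.subset (by rintro _ ⟨p, hp, rfl⟩; exact hp)
  hom_finite X Y := (hG.hom_finite X Y).subset fun _ h => Subcat.mem_hom_of_imageHom_fst h

theorem Subcat.IsFinite.finite_carrier {C : Type u} [Category.{v} C] {G : Subcat C}
    (hG : G.IsFinite) : Finite G.Carrier := by
  have := hG.obj_finite.to_subtype
  exact Finite.of_injective (fun A : G.Carrier => (⟨A.val, A.mem⟩ : G.obj))
    (by rintro ⟨A, _⟩ ⟨B, _⟩ h; cases h; rfl)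

theorem Subcat.IsFinite.finite_hom {C : Type u} [Category.{v} C] {G : Subcat C}
    (hG : G.IsFinite) (A B : G.Carrier) : Finite (A ⟶ B) :=
  (hG.hom_finite A.val B.val).to_subtype

theorem finite_costructuredArrow {C : Type u} [Category.{v} C] {D : Type u'} [Category.{v'} D]
    (hD : ∀ X Y : D, Finite (X ⟶ Y)) [Finite C] (F : C ⥤ D) (X : D) :
    Finite (CostructuredArrow F X) := by
  have (A : C) : Finite (F.obj A ⟶ X) := hD _ _
  exact Finite.of_surjective (fun s : Σ A : C, F.obj A ⟶ X => CostructuredArrow.mk s.2)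
    fun T => ⟨⟨T.left, T.hom⟩, T.eq_mk.symm⟩

theorem finite_costructuredArrow_hom {C : Type u} [Category.{v} C] {D : Type u'} [Category.{v'} D]
    (hC : ∀ A B : C, Finite (A ⟶ B)) (F : C ⥤ D) (X : D) (S T : CostructuredArrow F X) :
    Finite (S ⟶ T) :=
  have := hC S.left T.left
  Finite.of_injective (fun f : S ⟶ T => f.left) fun _ _ h => CostructuredArrow.hom_ext _ _ h

/-- An object is the colimit of its standard diagram in a dense subcategory. -/
theorem isColimit_standardCocone {C : Type u} [Category.{v} C] {G : Subcat C}
    (hG : G.incl.IsDense) (X : C) : Nonempty (IsColimit (standardCocone G X)) := by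
  obtain ⟨h⟩ := hG.isDenseAt X
  refine ⟨IsColimit.ofIsoColimit h (Cocone.ext (Iso.refl _) fun T => ?_)⟩
  refine (Category.comp_id _).trans ?_
  exact (Category.id_comp T.hom)

namespace CategoricalGandyMachine

variable {C : Type u} [Category.{v} C] {U : C ⥤ C} (M : CategoricalGandyMachine U)

/-! ### Minimal causal neighbourhoods. -/

section Factorization

variable {A X : C} (a : A ⟶ U.obj X)

/-- A morphism `a : A ⟶ U X` as an object of `C ↓ U`. -/
abbrev commaMk {U : C ⥤ C} {A X : C} (a : A ⟶ U.obj X) : Comma (𝟭 C) U := ⟨A, X, a⟩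

/-- The morphism of `C ↓ C` out of `F a` that corresponds to a factorization `e ≫ U h = a ≫ U z`. -/
def transpose {N Z : C} (e : A ⟶ U.obj N) (h : N ⟶ Z) (z : X ⟶ Z)
    (w : e ≫ U.map h = a ≫ U.map z) :
    M.F.obj (commaMk a) ⟶ (⟨N, Z, h⟩ : Comma (𝟭 C) (𝟭 C)) :=
  (M.adj.homEquiv _ _).symm (⟨e, z, w⟩ : commaMk a ⟶ (commaLift U).obj ⟨N, Z, h⟩)

/-- The minimal causal neighbourhood of `a : A ⟶ U X`. -/
def causalNbhd : C := (M.F.obj (commaMk a)).left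

/-- The occurrence of `A` in the update of its minimal causal neighbourhood. -/
def causalOcc : A ⟶ U.obj (M.causalNbhd a) := (M.adj.unit.app (commaMk a)).left

/-- The minimal causal neighbourhood of `a : A ⟶ U X` maps to `X`. -/
def causalHom : M.causalNbhd a ⟶ X := (M.transpose a a (𝟙 X) (𝟙 X) rfl).left

theorem isCause_causalOcc : M.IsCause A (M.causalNbhd a) (M.causalOcc a) :=
  IsCause.mk (commaMk a)

variable {a}

theorem causalOcc_transpose {N Z : C} (e : A ⟶ U.obj N) (h : N ⟶ Z) (z : X ⟶ Z)
    (w : e ≫ U.map h = a ≫ U.map z) :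
    M.causalOcc a ≫ U.map (M.transpose a e h z w).left = e :=
  congrArg CommaMorphism.left
    (((M.adj.homEquiv_unit ..).symm.trans ((M.adj.homEquiv _ _).apply_symm_apply _)) :
      M.adj.unit.app (commaMk a) ≫ (commaLift U).map (M.transpose a e h z w) = ⟨e, z, w⟩)

variable (a) in
theorem causalOcc_causalHom : M.causalOcc a ≫ U.map (M.causalHom a) = a :=
  M.causalOcc_transpose ..

/-- Naturality of transposition: as squares into `𝟙 Z`, both sides are transposes of the same
morphism of `C ↓ U`, by `w`. -/
theorem transpose_hom {N Z : C} (e : A ⟶ U.obj N) (h : N ⟶ Z) (z : X ⟶ Z)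
    (w : e ≫ U.map h = a ≫ U.map z) :
    (M.transpose a e h z w).left ≫ h = M.causalHom a ≫ z := by
  have h1 : M.transpose a e h z w ≫ (⟨h, 𝟙 Z, rfl⟩ : (⟨N, Z, h⟩ : Comma (𝟭 C) (𝟭 C)) ⟶ ⟨Z, Z, 𝟙 Z⟩) =
      M.transpose a a (𝟙 X) (𝟙 X) rfl ≫
        (⟨z, z, (Category.comp_id _).trans (Category.id_comp _).symm⟩ :
          (⟨X, X, 𝟙 X⟩ : Comma (𝟭 C) (𝟭 C)) ⟶ ⟨Z, Z, 𝟙 Z⟩) := by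
    unfold transpose
    rw [← M.adj.homEquiv_naturality_right_symm, ← M.adj.homEquiv_naturality_right_symm]
    congr 1
    apply Comma.hom_ext
    · exact w
    · exact (Category.comp_id z).trans (Category.id_comp z).symm
  exact congrArg CommaMorphism.left h1

/-- The minimality of the causal neighbourhood, obtained by transposing the factorization with `z =
𝟙 X`. -/
theorem exists_factor {N : C} (e : A ⟶ U.obj N) (h : N ⟶ X) (w : e ≫ U.map h = a) :
    ∃ k : M.causalNbhd a ⟶ N, M.causalOcc a ≫ U.map k = e ∧ k ≫ h = M.causalHom a := by
  have w' : e ≫ U.map h = a ≫ U.map (𝟙 X) := by simp [w]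
  exact ⟨(M.transpose a e h (𝟙 X) w').left, M.causalOcc_transpose ..,
    (M.transpose_hom ..).trans (Category.comp_id _)⟩

/-- The uniqueness half of the adjunction. To apply it, `k` and `k'` must be completed to squares
over `h` with a common codomain component; `ρ.right ≫ z` serves for both, because `causalHom a`
factors through the arrow `F a`. -/
theorem causal_hom_ext {N Z : C} {k k' : M.causalNbhd a ⟶ N} {h : N ⟶ Z} {z : X ⟶ Z}
    (hk : k ≫ h = M.causalHom a ≫ z) (hk' : k' ≫ h = M.causalHom a ≫ z)
    (w : M.causalOcc a ≫ U.map k = M.causalOcc a ≫ U.map k') : k = k' := by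
  let ρ := M.transpose a a (𝟙 X) (𝟙 X) rfl
  have hρ : (M.F.obj (commaMk a)).hom ≫ ρ.right = M.causalHom a :=
    ρ.w.symm.trans (Category.comp_id _)
  have key (l : M.causalNbhd a ⟶ N) (hl : l ≫ h = M.causalHom a ≫ z) :
      l ≫ h = (M.F.obj (commaMk a)).hom ≫ ρ.right ≫ z := by
    rw [hl, ← hρ]
    exact Category.assoc _ _ _
  let κ : M.F.obj (commaMk a) ⟶ (⟨N, Z, h⟩ : Comma (𝟭 C) (𝟭 C)) := ⟨k, ρ.right ≫ z, key k hk⟩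
  let κ' : M.F.obj (commaMk a) ⟶ (⟨N, Z, h⟩ : Comma (𝟭 C) (𝟭 C)) := ⟨k', ρ.right ≫ z, key k' hk'⟩
  have h1 : κ = κ' := by
    apply (M.adj.homEquiv _ _).injective
    rw [M.adj.homEquiv_unit, M.adj.homEquiv_unit]
    apply Comma.hom_ext
    · exact w
    · rfl
  exact congrArg CommaMorphism.left h1

/-- The morphism of minimal causal neighbourhoods induced by a commutative square. -/
def causalMap {A' X' : C} {a' : A' ⟶ U.obj X'} (b : A ⟶ A') (z : X ⟶ X')
    (w : b ≫ a' = a ≫ U.map z) : M.causalNbhd a ⟶ M.causalNbhd a' :=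
  (M.F.map (⟨b, z, w⟩ : commaMk a ⟶ commaMk a')).left

theorem causalOcc_causalMap {A' X' : C} {a' : A' ⟶ U.obj X'} (b : A ⟶ A') (z : X ⟶ X')
    (w : b ≫ a' = a ≫ U.map z) :
    M.causalOcc a ≫ U.map (M.causalMap b z w) = b ≫ M.causalOcc a' :=
  congrArg CommaMorphism.left
    (M.adj.unit.naturality (⟨b, z, w⟩ : commaMk a ⟶ commaMk a')).symm

theorem causalMap_causalHom {A' X' : C} {a' : A' ⟶ U.obj X'} (b : A ⟶ A') (z : X ⟶ X')
    (w : b ≫ a' = a ≫ U.map z) :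
    M.causalMap b z w ≫ M.causalHom a' = M.causalHom a ≫ z := by
  have h1 : M.F.map (⟨b, z, w⟩ : commaMk a ⟶ commaMk a') ≫ M.transpose a' a' (𝟙 X') (𝟙 X') rfl =
      M.transpose a a (𝟙 X) (𝟙 X) rfl ≫
        (⟨z, z, (Category.comp_id _).trans (Category.id_comp _).symm⟩ :
          (⟨X, X, 𝟙 X⟩ : Comma (𝟭 C) (𝟭 C)) ⟶ ⟨X', X', 𝟙 X'⟩) := by
    unfold transpose
    rw [← M.adj.homEquiv_naturality_right_symm, ← M.adj.homEquiv_naturality_left_symm]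
    congr 1
    apply Comma.hom_ext
    · exact w
    · exact (Category.comp_id z).trans (Category.id_comp z).symm
  exact congrArg CommaMorphism.left h1

theorem causalMap_mem {G : Subcat C} {A' X' : C} {a' : A' ⟶ U.obj X'} (b : A ⟶ A') (z : X ⟶ X')
    (w : b ≫ a' = a ≫ U.map z) (hb : b ∈ G.hom A A') :
    M.causalMap b z w ∈ (M.neighbourhoods G).hom (M.causalNbhd a) (M.causalNbhd a') :=
  Subcat.ImageHom.map (S := G.overComma U) (F := M.F ⋙ Comma.fst (𝟭 C) (𝟭 C))
    (⟨b, z, w⟩ : commaMk a ⟶ commaMk a') hb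

/-- The minimal causal neighbourhood of an occurrence that is itself minimal maps to the latter by a
morphism in the category of neighbourhoods. -/
theorem causalHom_mem_of_isCause {G : Subcat C} {A N : C} {e : A ⟶ U.obj N} (hA : A ∈ G.obj)
    (he : M.IsCause A N e) :
    M.causalHom e ∈ (M.neighbourhoods G).hom (M.causalNbhd e) N := by
  cases he with
  | mk p =>
    change M.causalHom (M.causalOcc p.hom) ∈
      (M.neighbourhoods G).hom (M.causalNbhd (M.causalOcc p.hom)) (M.causalNbhd p.hom)
    have w : 𝟙 p.left ≫ p.hom = M.causalOcc p.hom ≫ U.map (M.causalHom p.hom) := by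
      rw [M.causalOcc_causalHom]; exact Category.id_comp _
    -- The right-hand side is the image under `F` of a square with identity domain component, hence
    -- lies in the image of `G ↓ U`.
    have h1 : M.causalHom (M.causalOcc p.hom) = M.causalMap (𝟙 p.left) (M.causalHom p.hom) w := by
      apply M.causal_hom_ext (h := M.causalHom p.hom) (z := M.causalHom p.hom) rfl
        (M.causalMap_causalHom ..)
      rw [M.causalOcc_causalHom, M.causalOcc_causalMap]
      exact (Category.id_comp _).symm
    rw [h1]
    exact M.causalMap_mem _ _ _ (G.id_mem hA)

end Factorization

/-! ### Finiteness of the precomputed data. -/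

section Finiteness

variable (G : Subcat C)

theorem neighbourhoods_isFinite (hG : G.IsFinite) : (M.neighbourhoods G).IsFinite :=
  M.finite_image _ (hG.image_overComma_fst U)

theorem finite_rule (hG : G.IsFinite) : Finite (M.Rule G) := by
  have := hG.finite_carrier
  have := (M.neighbourhoods_isFinite G hG).obj_finite.to_subtype
  have (A N : C) : Finite (A ⟶ N) := M.locallyFinite A N
  exact Finite.of_injective
    (fun P : M.Rule G => (⟨(P.shape, ⟨P.nbhd, P.nbhd_mem⟩), P.occ⟩ :
      Σ s : G.Carrier × (M.neighbourhoods G).obj, (G.incl.obj s.1 ⟶ U.obj s.2.1)))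
    (by rintro ⟨A, N, e, _⟩ ⟨A', N', e', _⟩ h; cases h; rfl)

theorem finite_rule_hom (hG : G.IsFinite) (P Q : M.Rule G) : Finite (P ⟶ Q) := by
  have := hG.finite_hom P.shape Q.shape
  have := M.locallyFinite P.nbhd Q.nbhd
  exact Finite.of_injective (fun f : P ⟶ Q => (Rule.Hom.shape f, Rule.Hom.nbhd f)) fun _ _ h =>
    Rule.Hom.ext (congrArg Prod.fst h) (congrArg Prod.snd h)

end Finiteness

/-! ### The update as a colimit of triangles. -/

section Colimit

variable (G : Subcat C)

variable {G} in
/-- A triangle with apex `X` from a rule and a morphism from its neighbourhood to `X`. -/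
def triangleMk {X : C} (P : M.Rule G) (h : P.nbhd ⟶ X) : M.Triangles G X :=
  CostructuredArrow.mk (S := M.nbhdFunctor G) (Y := P) h

/-- The rule given by the minimal causal neighbourhood of an element of `U X`. -/
def causalRule {X : C} (A : G.Carrier) (a : A.val ⟶ U.obj X) : M.Rule G :=
  ⟨A, M.causalNbhd a, M.causalOcc a, M.isCause_causalOcc a⟩

/-- The triangle of the minimal causal neighbourhood of an element of `U X`. -/
def causalTriangle (X : C) (T : CostructuredArrow G.incl (U.obj X)) : M.Triangles G X :=
  M.triangleMk (M.causalRule G T.left T.hom) (M.causalHom T.hom)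

/-- The element of `U X` that a triangle with apex `X` occupies. -/
def triangleElement {X : C} (T : M.Triangles G X) : CostructuredArrow G.incl (U.obj X) :=
  CostructuredArrow.mk (Y := T.left.shape) (T.left.occ ≫ U.map T.hom)

theorem triangleElement_causalTriangle (X : C) (T : CostructuredArrow G.incl (U.obj X)) :
    M.triangleElement G (M.causalTriangle G X T) = T := by
  refine Eq.trans ?_ T.eq_mk.symm
  have h : M.causalOcc T.hom ≫ U.map (M.causalHom T.hom) = T.hom := M.causalOcc_causalHom T.hom
  exact congrArg (fun h => CostructuredArrow.mk (S := G.incl) (Y := T.left) h) h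

/-- A morphism of triangles from a morphism of shapes and a morphism of neighbourhoods. -/
def triangleHom {X : C} {S T : M.Triangles G X} (b : S.left.shape ⟶ T.left.shape)
    (k : S.left.nbhd ⟶ T.left.nbhd)
    (hk : k ∈ (M.neighbourhoods G).hom S.left.nbhd T.left.nbhd)
    (w : S.left.occ ≫ U.map k = G.incl.map b ≫ T.left.occ) (h : k ≫ T.hom = S.hom) : S ⟶ T :=
  CostructuredArrow.homMk (⟨b, k, hk, w⟩ : Rule.Hom S.left T.left) h

/-- A morphism between elements of `U X` lifts to the triangles of their causal neighbourhoods. -/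
def causalTriangleMap {X : C} {S T : CostructuredArrow G.incl (U.obj X)} (f : S ⟶ T) :
    M.causalTriangle G X S ⟶ M.causalTriangle G X T :=
  have w : G.incl.map f.left ≫ T.hom = S.hom ≫ U.map (𝟙 X) := by
    rw [U.map_id, CostructuredArrow.w f]; exact (Category.comp_id _).symm
  M.triangleHom G f.left (M.causalMap (a := S.hom) (a' := T.hom) (G.incl.map f.left) (𝟙 X) w)
    (M.causalMap_mem _ _ _ f.left.2) (M.causalOcc_causalMap _ _ w)
    ((M.causalMap_causalHom (a := S.hom) (a' := T.hom) _ _ w).trans (Category.comp_id _))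

/-- A span joins the two triangles, with apex the causal neighbourhood of the occurrence `e` itself.
Both its sides are the identity on shapes, so the legs agree. `exists_factor` would give a direct
morphism, but without membership in the category of neighbourhoods. -/
theorem leg_eq_leg_causalTriangle {X : C} (s : Cocone (M.diagram G X ⋙ G.incl))
    (T : M.Triangles G X) :
    s.ι.app T = s.ι.app (M.causalTriangle G X (M.triangleElement G T)) := by
  let e : T.left.shape.val ⟶ U.obj T.left.nbhd := T.left.occ
  have hocc : M.causalOcc e ≫ U.map (M.causalHom e) = e := M.causalOcc_causalHom e
  let S : M.Triangles G X := M.triangleMk (M.causalRule G T.left.shape e) (M.causalHom e ≫ T.hom)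
  let m : S ⟶ T := M.triangleHom G (𝟙 _) (M.causalHom e)
    (M.causalHom_mem_of_isCause T.left.shape.mem T.left.isCause)
    (hocc.trans ((congrArg (· ≫ e) (G.incl.map_id T.left.shape)).trans (Category.id_comp e)).symm)
    rfl
  have w : 𝟙 T.left.shape.val ≫ (e ≫ U.map T.hom) = e ≫ U.map T.hom := Category.id_comp _
  let k : S ⟶ M.causalTriangle G X (M.triangleElement G T) :=
    M.triangleHom G (𝟙 _) (M.causalMap (a := e) (a' := e ≫ U.map T.hom) (𝟙 T.left.shape.val) T.hom w)
      (M.causalMap_mem _ _ _ (G.id_mem T.left.shape.mem))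
      (M.causalOcc_causalMap (a := e) (a' := e ≫ U.map T.hom) _ _ w)
      (M.causalMap_causalHom (a := e) (a' := e ≫ U.map T.hom) _ _ w)
  have hm : 𝟙 _ ≫ s.ι.app T = s.ι.app S := s.w m
  have hk : 𝟙 _ ≫ s.ι.app (M.causalTriangle G X (M.triangleElement G T)) = s.ι.app S := s.w k
  exact (Category.id_comp _).symm.trans ((hm.trans hk.symm).trans (Category.id_comp _))

theorem isColimit_cocone (hG : G.incl.IsDense) (X : C) : Nonempty (IsColimit (M.cocone G X)) := by
  obtain ⟨hc⟩ := isColimit_standardCocone hG (U.obj X)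
  -- Restriction of a cocone along the passage from elements to minimal triangles.
  let t (s : Cocone (M.diagram G X ⋙ G.incl)) : Cocone (standardDiagram G (U.obj X) ⋙ G.incl) :=
    { pt := s.pt
      ι :=
        { app := fun T => s.ι.app (M.causalTriangle G X T)
          naturality := fun S T f => (s.ι.naturality (M.causalTriangleMap G f) :) } }
  refine ⟨⟨fun s => hc.desc (t s), fun s T => ?_, fun s m hm => hc.hom_ext fun T => ?_⟩⟩
  · exact (hc.fac (t s) (M.triangleElement G T)).trans (M.leg_eq_leg_causalTriangle G s T).symm
  · refine Eq.trans ?_ ((hm (M.causalTriangle G X T)).trans (hc.fac (t s) T).symm)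
    have h : M.causalOcc T.hom ≫ U.map (M.causalHom T.hom) = T.hom := M.causalOcc_causalHom T.hom
    exact congrArg (· ≫ m) h.symm

end Colimit

end CategoricalGandyMachine

/-! ### Representatives of classes in a list. -/

section Representatives

variable {α : Type*}

open Classical in
/-- A list of representatives for the classes of a relation on the members of a list. -/
noncomputable def representatives (rel : α → α → Prop) (l : List α) : List α :=
  l.foldr (fun u acc => if ∃ v ∈ acc, rel v u then acc else u :: acc) []

theorem representatives_subset (rel : α → α → Prop) (l : List α) :
    representatives rel l ⊆ l := by
  induction l with
  | nil => exact List.Subset.refl _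
  | cons u l ih =>
    rw [representatives, List.foldr_cons]
    split_ifs with h
    · exact List.subset_cons_of_subset _ ih
    · exact List.cons_subset_cons _ ih

theorem exists_mem_representatives {rel : α → α → Prop} {l : List α} (hrel : ∀ u ∈ l, rel u u)
    {u : α} (hu : u ∈ l) : ∃ v ∈ representatives rel l, rel v u := by
  induction l with
  | nil => simp at hu
  | cons a l ih =>
    have ih' := ih fun u hu => hrel u (List.mem_cons_of_mem _ hu)
    rw [representatives, List.foldr_cons]
    rcases List.mem_cons.1 hu with rfl | hu
    · split_ifs with h
      · exact h
      · exact ⟨u, List.mem_cons_self, hrel u List.mem_cons_self⟩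
    · obtain ⟨v, hv, h⟩ := ih' hu
      split_ifs
      · exact ⟨v, hv, h⟩
      · exact ⟨v, List.mem_cons_of_mem _ hv, h⟩

theorem pairwise_representatives (rel : α → α → Prop) (l : List α) :
    (representatives rel l).Pairwise fun u v => ¬ rel v u := by
  induction l with
  | nil => exact List.Pairwise.nil
  | cons a l ih =>
    rw [representatives, List.foldr_cons]
    split_ifs with h
    · exact ih
    · exact List.Pairwise.cons (fun v hv hva => h ⟨v, hv, hva⟩) ih

end Representatives

/-! ### Primitive recursive bounded search. -/

section PrimitiveRecursion

variable {α β γ : Type*} [Primcodable α] [Primcodable β] [Primcodable γ]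

theorem primrecPred_exists_mem {f : α → List β} {p : α → β → Prop} (hf : Primrec f)
    (hp : PrimrecRel p) : PrimrecPred fun a => ∃ b ∈ f a, p a b :=
  (PrimrecRel.exists_mem_list (R := fun b a => p a b) (hp.comp Primrec.snd Primrec.fst)).comp hf
    Primrec.id

theorem primrecPred_forall_mem {f : α → List β} {p : α → β → Prop} (hf : Primrec f)
    (hp : PrimrecRel p) : PrimrecPred fun a => ∀ b ∈ f a, p a b :=
  (PrimrecRel.forall_mem_list (R := fun b a => p a b) (hp.comp Primrec.snd Primrec.fst)).comp hf
    Primrec.id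

open Classical in
theorem primrec_filter {f : α → List β} {p : α → β → Prop} (hf : Primrec f)
    (hp : PrimrecRel p) : Primrec fun a => (f a).filter (p a ·) :=
  (PrimrecRel.listFilter (R := fun b a => p a b) (hp.comp Primrec.snd Primrec.fst)).comp hf
    Primrec.id

theorem primrec_representatives {f : α → List β} {rel : α → β → β → Prop} (hf : Primrec f)
    (hrel : PrimrecPred fun t : α × β × β => rel t.1 t.2.1 t.2.2) :
    Primrec fun a => representatives (rel a) (f a) := by
  classical
  refine Primrec.list_foldr
    (h := fun a (t : β × List β) => if ∃ v ∈ t.2, rel a v t.1 then t.2 else t.1 :: t.2)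
    hf (Primrec.const []) ?_
  refine Primrec.ite ?_ (Primrec.snd.comp Primrec.snd)
    (Primrec.list_cons.comp (Primrec.fst.comp Primrec.snd) (Primrec.snd.comp Primrec.snd))
  exact primrecPred_exists_mem (p := fun (t : α × β × List β) v => rel t.1 v t.2.1)
    (Primrec.snd.comp Primrec.snd)
    (hrel.comp (Primrec.pair (Primrec.fst.comp Primrec.fst)
      (Primrec.pair Primrec.snd (Primrec.fst.comp (Primrec.snd.comp Primrec.fst)))))

end PrimitiveRecursion

/-! ### Codes of diagrams given by finite presentations. -/

section Codes

variable {C : Type u} [Category.{v} C] {G : Subcat C} (ν : Numbering G)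

/-- `c` is a code of the diagram `D` with respect to a given enumeration of its index category. -/
def IsCodeWith {J : Type w} [Category.{w'} J] (D : J ⥤ G.Carrier) (c : DiagramCode)
    (x : Fin c.1.length ≃ J) : Prop :=
  (∀ i, c.1.get i = ν.obj (D.obj (x i))) ∧
    ∀ s t g : ℕ, (s, t, g) ∈ c.2 ↔
      ∃ (i j : Fin c.1.length) (φ : x i ⟶ x j),
        i.val = s ∧ j.val = t ∧ ν.hom (D.map φ) = g

theorem IsCodeWith.mem_iff {ν : Numbering G} {J : Type w} [Category.{w'} J] {D : J ⥤ G.Carrier}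
    {c : DiagramCode} {x : Fin c.1.length ≃ J} (h : IsCodeWith ν D c x)
    (i j : Fin c.1.length) (g : ℕ) :
    (i.val, j.val, g) ∈ c.2 ↔ ∃ φ : x i ⟶ x j, ν.hom (D.map φ) = g := by
  rw [h.2]
  constructor
  · rintro ⟨i', j', φ, hi, hj, hg⟩
    cases Fin.ext hi
    cases Fin.ext hj
    exact ⟨φ, hg⟩
  · rintro ⟨φ, hg⟩
    exact ⟨i, j, φ, rfl, rfl, hg⟩

theorem exists_isCode {J : Type w} [Category.{w'} J] [Finite J]
    (hJ : ∀ i j : J, Finite (i ⟶ j)) (D : J ⥤ G.Carrier) : ∃ c, IsCode ν D c := by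
  obtain ⟨n, ⟨e⟩⟩ := Finite.exists_equiv_fin J
  let l : List ℕ := List.ofFn fun i => ν.obj (D.obj (e.symm i))
  have hl : l.length = n := List.length_ofFn
  let x : Fin l.length ≃ J := (finCongr hl).trans e.symm
  let label (s : Σ (i j : Fin l.length), x i ⟶ x j) : ℕ × ℕ × ℕ :=
    (s.1.val, s.2.1.val, ν.hom (D.map s.2.2))
  have hfin : (Set.range label).Finite := by
    have (i j : Fin l.length) : Finite (x i ⟶ x j) := hJ _ _
    exact Set.finite_range label
  refine ⟨(l, hfin.toFinset.toList), x, fun i => ?_, fun s t g => ?_⟩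
  · simp [l, x]
    rfl
  · simp only [Finset.mem_toList, Set.Finite.mem_toFinset, Set.mem_range, label, Prod.mk.injEq]
    constructor
    · rintro ⟨⟨i, j, φ⟩, h⟩
      exact ⟨i, j, φ, h⟩
    · rintro ⟨i, j, φ, h⟩
      exact ⟨⟨i, j, φ⟩, h⟩

/-- Labels of morphisms of a finite subcategory are bounded. -/
theorem Numbering.exists_labels (hG : G.IsFinite) :
    ∃ Λ : List ℕ, ∀ (A B : G.Carrier) (f : A ⟶ B), ν.hom f ∈ Λ := by
  have := hG.finite_carrier
  have := hG.finite_hom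
  have hfin := Set.finite_range fun s : Σ A B : G.Carrier, A ⟶ B => ν.hom s.2.2
  exact ⟨hfin.toFinset.toList, fun A B f => by
    rw [Finset.mem_toList, Set.Finite.mem_toFinset]; exact ⟨⟨A, B, f⟩, rfl⟩⟩

/-- `rep` exhibits the index category of `D` as the set of classes of a relation on the members of
a list, with given labels of objects and morphisms. -/
structure IsPresentation {α : Type*} {J : Type w} [Category.{w'} J] (D : J ⥤ G.Carrier)
    (l : List α) (label : α → ℕ) (rel : α → α → Prop) (edge : α → α → ℕ → Prop)
    (rep : α → J → Prop) : Prop where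
  total : ∀ a ∈ l, ∃ j, rep a j
  surjective : ∀ j, ∃ a ∈ l, rep a j
  label_eq : ∀ {a j}, rep a j → label a = ν.obj (D.obj j)
  rel_iff : ∀ {a b i j}, a ∈ l → b ∈ l → rep a i → rep b j → (rel a b ↔ i = j)
  edge_iff : ∀ {a b i j g}, a ∈ l → b ∈ l → rep a i → rep b j →
    (edge a b g ↔ ∃ φ : i ⟶ j, ν.hom (D.map φ) = g)

open Classical in
/-- The code of a diagram with a given list of vertices. -/
noncomputable def codeOf {α : Type*} [DecidableEq α] (Λ : List ℕ) (r : List α) (label : α → ℕ)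
    (edge : α → α → ℕ → Prop) : DiagramCode :=
  (r.map label, r.flatMap fun a => r.flatMap fun b =>
    (Λ.filter (edge a b ·)).map fun g => (r.idxOf a, r.idxOf b, g))

variable {ν} in
-- On members of `l` the relation is equality of the represented objects, so the chosen
-- representatives are in bijection with the index category.
theorem IsPresentation.isCode {α : Type*} [DecidableEq α] {J : Type w} [Category.{w'} J]
    {D : J ⥤ G.Carrier} {l : List α} {label : α → ℕ} {rel : α → α → Prop}
    {edge : α → α → ℕ → Prop} {rep : α → J → Prop}
    (h : IsPresentation ν D l label rel edge rep) {Λ : List ℕ}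
    (hΛ : ∀ (A B : G.Carrier) (f : A ⟶ B), ν.hom f ∈ Λ) :
    IsCode ν D (codeOf Λ (representatives rel l) label edge) := by
  set r := representatives rel l with hr
  have hsub : r ⊆ l := representatives_subset rel l
  have hrefl : ∀ u ∈ l, rel u u := fun u hu => by
    obtain ⟨j, hj⟩ := h.total u hu
    exact (h.rel_iff hu hu hj hj).2 rfl
  have hpair : r.Pairwise fun u v => ¬ rel v u := pairwise_representatives rel l
  have hnodup : r.Nodup := hpair.imp_of_mem fun {a b} ha _ hab heq =>
    hab (heq ▸ hrefl a (hsub ha))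
  choose f hf using fun i : Fin r.length => h.total (r.get i) (hsub (List.get_mem r i))
  have hinj : Function.Injective f := by
    have key (i j : Fin r.length) (hij : f i = f j) : ¬ i < j := fun hlt =>
      List.pairwise_iff_get.1 hpair i j hlt
        ((h.rel_iff (hsub (List.get_mem ..)) (hsub (List.get_mem ..)) (hf j) (hf i)).2 hij.symm)
    exact fun i j hij => le_antisymm (not_lt.1 (key j i hij.symm)) (not_lt.1 (key i j hij))
  have hsurj : Function.Surjective f := fun j => by
    obtain ⟨a, ha, haj⟩ := h.surjective j
    obtain ⟨b, hb, hba⟩ := exists_mem_representatives hrefl ha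
    obtain ⟨i, rfl⟩ := List.get_of_mem (hr ▸ hb)
    exact ⟨i, (h.rel_iff (hsub hb) ha (hf i) haj).1 hba⟩
  have hlen : (r.map label).length = r.length := List.length_map label
  let x : Fin (r.map label).length ≃ J :=
    (finCongr hlen).trans (Equiv.ofBijective f ⟨hinj, hsurj⟩)
  refine ⟨x, fun i => ?_, fun s t g => ?_⟩
  · have hget : (r.map label).get i = label (r.get (Fin.cast hlen i)) := List.getElem_map label
    exact hget.trans (h.label_eq (hf (Fin.cast hlen i)))
  · have hx (i : Fin (r.map label).length) : rep (r.get (Fin.cast hlen i)) (x i) :=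
      hf (Fin.cast hlen i)
    -- The absence of repetitions makes `idxOf` recover positions, which are the vertex names used
    -- in the edges.
    have hidx (i : Fin r.length) : r.idxOf (r.get i) = i.val := List.get_idxOf hnodup i
    simp only [codeOf, List.mem_flatMap, List.mem_map, List.mem_filter, decide_eq_true_eq,
      Prod.mk.injEq]
    constructor
    · rintro ⟨a, ha, b, hb, g', ⟨-, he⟩, rfl, rfl, rfl⟩
      obtain ⟨i, rfl⟩ := List.get_of_mem ha
      obtain ⟨j, rfl⟩ := List.get_of_mem hb
      obtain ⟨φ, hφ⟩ := (h.edge_iff (hsub ha) (hsub hb) (hf i) (hf j)).1 he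
      exact ⟨Fin.cast hlen.symm i, Fin.cast hlen.symm j, φ,
        (hidx i).symm, (hidx j).symm, hφ⟩
    · rintro ⟨i, j, φ, rfl, rfl, rfl⟩
      exact ⟨_, List.get_mem r (Fin.cast hlen i), _,
        List.get_mem r (Fin.cast hlen j), _,
        ⟨hΛ _ _ _, (h.edge_iff (hsub (List.get_mem ..)) (hsub (List.get_mem ..)) (hx i) (hx j)).2
          ⟨φ, rfl⟩⟩, hidx _, hidx _, rfl⟩

theorem primrec_codeOf {α β : Type*} [Primcodable α] [Primcodable β] [DecidableEq β] (Λ : List ℕ)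
    {r : α → List β} {label : β → ℕ} {edge : α → β → β → ℕ → Prop} (hr : Primrec r)
    (hlabel : Primrec label)
    (hedge : PrimrecPred fun t : α × β × β × ℕ => edge t.1 t.2.1 t.2.2.1 t.2.2.2) :
    Primrec fun a => codeOf Λ (r a) label (edge a) := by
  refine Primrec.pair (Primrec.list_map hr (hlabel.comp Primrec.snd)) ?_
  refine Primrec.list_flatMap hr (Primrec.list_flatMap (hr.comp Primrec.fst) (Primrec.list_map
    (primrec_filter (p := fun (t : (α × β) × β) g => edge t.1.1 t.1.2 t.2 g) (Primrec.const Λ) ?_)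
    ?_))
  · exact hedge.comp (Primrec.pair (Primrec.fst.comp (Primrec.fst.comp Primrec.fst))
      (Primrec.pair (Primrec.snd.comp (Primrec.fst.comp Primrec.fst))
        (Primrec.pair (Primrec.snd.comp Primrec.fst) Primrec.snd)))
  · have hr' : Primrec fun t : ((α × β) × β) × ℕ => r t.1.1.1 :=
      hr.comp (Primrec.fst.comp (Primrec.fst.comp Primrec.fst))
    exact Primrec.pair
      (Primrec.list_idxOf.comp (Primrec.snd.comp (Primrec.fst.comp Primrec.fst)) hr')
      (Primrec.pair (Primrec.list_idxOf.comp (Primrec.snd.comp Primrec.fst) hr') Primrec.snd)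

end Codes

/-! ### Enumeration of graph homomorphisms. -/

section GraphHoms

/-- The lists of a given length with members below a given bound. -/
def listsBelow (n m : ℕ) : List (List ℕ) :=
  n.rec [[]] fun _ acc => acc.flatMap fun l => (List.range m).map (· :: l)

theorem mem_listsBelow {n m : ℕ} {l : List ℕ} :
    l ∈ listsBelow n m ↔ l.length = n ∧ ∀ a ∈ l, a < m := by
  induction n generalizing l with
  | zero =>
    change l ∈ [[]] ↔ _
    rw [List.mem_singleton, List.length_eq_zero_iff]
    exact ⟨by rintro rfl; simp, And.left⟩
  | succ n ih =>
    have : l ∈ listsBelow (n + 1) m ↔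
        ∃ l' ∈ listsBelow n m, ∃ a ∈ List.range m, a :: l' = l := by
      simp only [listsBelow, List.mem_flatMap, List.mem_map]
    rw [this]
    constructor
    · rintro ⟨l', hl', a, ha, rfl⟩
      rw [ih] at hl'
      simp only [List.length_cons, hl'.1, List.mem_cons, true_and]
      rintro b (rfl | hb)
      · exact List.mem_range.1 ha
      · exact hl'.2 b hb
    · rintro ⟨hn, hl⟩
      cases l with
      | nil => simp at hn
      | cons a l =>
        exact ⟨l, ih.2 ⟨by simpa using hn, fun b hb => hl b (List.mem_cons_of_mem _ hb)⟩, a,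
          List.mem_range.2 (hl a List.mem_cons_self), rfl⟩

theorem primrec_listsBelow : Primrec₂ listsBelow := by
  refine Primrec.nat_rec' (f := fun t : ℕ × ℕ => t.1) (g := fun _ => [[]])
    (h := fun t s => s.2.flatMap fun l => (List.range t.2).map (· :: l)) Primrec.fst
    (Primrec.const _) ?_
  exact Primrec.list_flatMap (Primrec.snd.comp Primrec.snd) (Primrec.list_map
    (Primrec.list_range.comp (Primrec.snd.comp (Primrec.fst.comp Primrec.fst)))
    (Primrec.list_cons.comp Primrec.snd (Primrec.snd.comp Primrec.fst)))

/-- A homomorphism between labelled graphs, as the list of its values on vertices. -/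
def IsGraphHom (d c : DiagramCode) (l : List ℕ) : Prop :=
  (l.map fun i => c.1[i]?) = d.1.map some ∧
    ∀ e ∈ d.2, (l.getD e.1 0, l.getD e.2.1 0, e.2.2) ∈ c.2

open Classical in
/-- The list of all homomorphisms between two labelled graphs. -/
noncomputable def graphHoms (d c : DiagramCode) : List (List ℕ) :=
  (listsBelow d.1.length c.1.length).filter (IsGraphHom d c ·)

/-- The search bounds lose nothing: an index out of range would give `none` where the label
condition demands `some`. -/
theorem mem_graphHoms {d c : DiagramCode} {l : List ℕ} : l ∈ graphHoms d c ↔ IsGraphHom d c l := by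
  simp only [graphHoms, List.mem_filter, mem_listsBelow, decide_eq_true_eq, and_iff_right_iff_imp]
  rintro ⟨h, -⟩
  refine ⟨by simpa using congrArg List.length h, fun a ha => ?_⟩
  have : c.1[a]? ∈ d.1.map some := h ▸ List.mem_map_of_mem ha
  obtain ⟨b, -, hb⟩ := List.mem_map.1 this
  exact (List.getElem?_eq_some_iff.1 hb.symm).1

theorem primrec_graphHoms : Primrec₂ graphHoms := by
  have hd : Primrec fun t : (DiagramCode × DiagramCode) × List ℕ => t.1.1 :=
    Primrec.fst.comp Primrec.fst
  have hc : Primrec fun t : (DiagramCode × DiagramCode) × List ℕ => t.1.2 :=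
    Primrec.snd.comp Primrec.fst
  refine primrec_filter (p := fun (t : DiagramCode × DiagramCode) l => IsGraphHom t.1 t.2 l)
    (primrec_listsBelow.comp (Primrec.list_length.comp (Primrec.fst.comp Primrec.fst))
      (Primrec.list_length.comp (Primrec.fst.comp Primrec.snd))) ?_
  refine PrimrecPred.and (Primrec.eq.comp
    (Primrec.list_map Primrec.snd (Primrec.list_getElem?.comp
      (Primrec.fst.comp (hc.comp Primrec.fst)) Primrec.snd))
    (Primrec.list_map (Primrec.fst.comp hd) (Primrec.option_some.comp Primrec.snd))) ?_
  refine primrecPred_forall_mem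
    (p := fun (t : (DiagramCode × DiagramCode) × List ℕ) (e : ℕ × ℕ × ℕ) =>
      (t.2.getD e.1 0, t.2.getD e.2.1 0, e.2.2) ∈ t.1.2.2) (Primrec.snd.comp hd) ?_
  -- Membership in the edge list is rewritten as a bounded search for an equal member.
  refine PrimrecPred.of_eq (primrecPred_exists_mem
    (p := fun (t : ((DiagramCode × DiagramCode) × List ℕ) × ℕ × ℕ × ℕ) e =>
      e = (t.1.2.getD t.2.1 0, t.1.2.getD t.2.2.1 0, t.2.2.2))
    (Primrec.snd.comp (hc.comp Primrec.fst)) ?_) (fun t => exists_eq_right)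
  have hl : Primrec fun t : (((DiagramCode × DiagramCode) × List ℕ) × ℕ × ℕ × ℕ) × ℕ × ℕ × ℕ =>
      t.1.1.2 := Primrec.snd.comp (Primrec.fst.comp Primrec.fst)
  have he : Primrec fun t : (((DiagramCode × DiagramCode) × List ℕ) × ℕ × ℕ × ℕ) × ℕ × ℕ × ℕ =>
      t.1.2 := Primrec.snd.comp Primrec.fst
  exact Primrec.eq.comp Primrec.snd (Primrec.pair
    ((Primrec.list_getD 0).comp hl (Primrec.fst.comp he))
    (Primrec.pair ((Primrec.list_getD 0).comp hl (Primrec.fst.comp (Primrec.snd.comp he)))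
      (Primrec.snd.comp (Primrec.snd.comp he))))

end GraphHoms

/-! ### Morphisms as graph homomorphisms between codes. -/

section Encoding

variable {C : Type u} [Category.{v} C] {G : Subcat C} {ν : Numbering G}

/-- A code of the standard diagram of an object, with an enumeration of the elements. -/
structure ObjectCode (ν : Numbering G) (X : C) where
  code : DiagramCode
  elements : Fin code.1.length ≃ CostructuredArrow G.incl X
  isCodeWith : IsCodeWith ν (standardDiagram G X) code elements

namespace ObjectCode

variable {N N' X : C} (d : ObjectCode ν N) (d' : ObjectCode ν N') (c : ObjectCode ν X)

/-- A morphism as the list of its values on the elements of its source. -/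
def encode (h : N ⟶ X) : List ℕ :=
  List.ofFn fun i => (c.elements.symm ((CostructuredArrow.map h).obj (d.elements i))).val

variable {d c} in
theorem encode_eq_iff {h : N ⟶ X} {l : List ℕ} :
    d.encode c h = l ↔ l.length = d.code.1.length ∧ ∀ i, l.getD (d.elements.symm i).val 0 =
      (c.elements.symm ((CostructuredArrow.map h).obj i)).val := by
  constructor
  · rintro rfl
    refine ⟨List.length_ofFn, fun T => ?_⟩
    obtain ⟨i, rfl⟩ := d.elements.surjective T
    simp [encode]
  · rintro ⟨hl, h⟩
    refine List.ext_getElem (by simp [encode, hl]) fun n h1 h2 => ?_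
    have := h (d.elements ⟨n, hl ▸ h2⟩)
    simp only [Equiv.symm_apply_apply, List.getD_eq_getElem?_getD, List.getElem?_eq_getElem h2,
      Option.getD_some] at this
    simp [encode, this]

theorem getD_encode (h : N ⟶ X) (T : CostructuredArrow G.incl N) :
    (d.encode c h).getD (d.elements.symm T).val 0 =
      (c.elements.symm ((CostructuredArrow.map h).obj T)).val :=
  (encode_eq_iff.1 rfl).2 T

/-- The list records the composites of `h` with all elements of `N`, and these elements are jointly
epic by density. -/
theorem encode_injective (hG : G.incl.IsDense) : Function.Injective (d.encode c) := by
  intro h h' heq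
  obtain ⟨hc⟩ := isColimit_standardCocone hG N
  refine hc.hom_ext fun T => ?_
  have key : (CostructuredArrow.map h).obj T = (CostructuredArrow.map h').obj T := by
    apply c.elements.symm.injective
    apply Fin.ext
    rw [← getD_encode d c, ← getD_encode d c, heq]
  exact eq_of_heq (Comma.mk.inj key).2.2

theorem encode_comp (k : N ⟶ N') (h : N' ⟶ X) :
    d.encode c (k ≫ h) = (d.encode d' k).map fun i => (d'.encode c h).getD i 0 := by
  change List.ofFn _ = (List.ofFn _).map _
  rw [List.map_ofFn]
  congr 1
  funext i
  rw [Function.comp_apply, getD_encode, CostructuredArrow.map_comp]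

theorem isGraphHom_encode (h : N ⟶ X) : IsGraphHom d.code c.code (d.encode c h) := by
  constructor
  · refine List.ext_getElem (by simp [encode]) fun n h1 h2 => ?_
    have hn : n < d.code.1.length := by simpa using h2
    have h3 := c.isCodeWith.1
      (c.elements.symm ((CostructuredArrow.map h).obj (d.elements ⟨n, hn⟩)))
    have h4 := d.isCodeWith.1 ⟨n, hn⟩
    rw [Equiv.apply_symm_apply] at h3
    simp only [encode, List.getElem_map, List.getElem_ofFn]
    exact (List.getElem?_eq_getElem _).trans (congrArg some (h3.trans h4.symm))
  · rintro ⟨s, t, g⟩ he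
    obtain ⟨i, j, φ, rfl, rfl, rfl⟩ := (d.isCodeWith.2 s t g).1 he
    have h1 := getD_encode d c h (d.elements i)
    have h2 := getD_encode d c h (d.elements j)
    rw [Equiv.symm_apply_apply] at h1 h2
    change (List.getD _ i.val 0, List.getD _ j.val 0, _) ∈ _
    rw [h1, h2, c.isCodeWith.mem_iff, Equiv.apply_symm_apply, Equiv.apply_symm_apply]
    exact ⟨(CostructuredArrow.map h).map φ, rfl⟩

/-- A graph homomorphism assigns to each element of `N` an element of `X` of the same shape, and
preservation of edges makes this a cocone on the standard diagram of `N`. Density turns it into a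
morphism. -/
theorem exists_encode_eq (hG : G.incl.IsDense) {l : List ℕ} (hl : IsGraphHom d.code c.code l) :
    ∃ h, d.encode c h = l := by
  have hlen : l.length = d.code.1.length := by simpa using congrArg List.length hl.1
  have hvert (i : Fin d.code.1.length) : c.code.1[l[i.val]]? = some (d.code.1.get i) := by
    have := List.getElem_of_eq hl.1 (i := i.val) (by simp [hlen])
    simpa using this
  have hlt (i : Fin d.code.1.length) : l[i.val] < c.code.1.length :=
    (List.getElem?_eq_some_iff.1 (hvert i)).1
  let img (T : CostructuredArrow G.incl N) : Fin c.code.1.length := ⟨_, hlt (d.elements.symm T)⟩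
  have hget (T) : l.getD (d.elements.symm T).val 0 = (img T).val :=
    List.getD_eq_getElem _ _ (by rw [hlen]; exact Fin.is_lt _)
  have himg (T) : c.code.1.get (img T) = ν.obj T.left := by
    have h1 := (List.getElem?_eq_some_iff.1 (hvert (d.elements.symm T))).2
    have h2 := d.isCodeWith.1 (d.elements.symm T)
    rw [Equiv.apply_symm_apply] at h2
    exact h1.trans h2
  have hex (T : CostructuredArrow G.incl N) :
      ∃ m : G.incl.obj T.left ⟶ X, c.elements (img T) = CostructuredArrow.mk m := by
    have h1 : ν.obj T.left = ν.obj (c.elements (img T)).left :=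
      (himg T).symm.trans (c.isCodeWith.1 (img T))
    have h2 := ν.obj_injective h1
    generalize c.elements (img T) = E at h2
    obtain ⟨A, ⟨⟨⟩⟩, m⟩ := E
    cases h2
    exact ⟨m, rfl⟩
  choose m hm using hex
  have hnat {S T : CostructuredArrow G.incl N} (φ : S ⟶ T) : G.incl.map φ.left ≫ m T = m S := by
    have h1 : ((d.elements.symm S).val, (d.elements.symm T).val, ν.hom φ.left) ∈ d.code.2 := by
      rw [d.isCodeWith.mem_iff, Equiv.apply_symm_apply, Equiv.apply_symm_apply]
      exact ⟨φ, rfl⟩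
    have h2 := hl.2 _ h1
    dsimp only at h2
    rw [hget, hget, c.isCodeWith.mem_iff, hm, hm] at h2
    obtain ⟨ψ, hψ⟩ := h2
    -- Labels are injective only within a hom-set; here source and target already agree.
    have h4 : ψ.left = φ.left := ν.hom_injective hψ
    rw [← h4]
    exact CostructuredArrow.w ψ
  obtain ⟨hc⟩ := isColimit_standardCocone hG N
  let s : Cocone (standardDiagram G N ⋙ G.incl) :=
    { pt := X
      ι :=
        { app := m
          naturality := fun S T φ => (hnat φ).trans (Category.comp_id _).symm } }
  obtain ⟨h, hh⟩ : ∃ h : N ⟶ X, ∀ T : CostructuredArrow G.incl N, T.hom ≫ h = m T :=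
    ⟨hc.desc s, hc.fac s⟩
  refine ⟨h, encode_eq_iff.2 ⟨hlen, fun T => ?_⟩⟩
  have h1 : (CostructuredArrow.map h).obj T = CostructuredArrow.mk (m T) :=
    congrArg (fun f => CostructuredArrow.mk (S := G.incl) (Y := T.left) f) (hh T)
  rw [h1, ← hm, Equiv.symm_apply_apply]
  exact hget T

end ObjectCode

end Encoding

/-! ### Finite tables for composition of encoded morphisms. -/

section Tables

variable {C : Type u} [Category.{v} C] {G : Subcat C} {ν : Numbering G}

/-- A pair of an index and a list of values maps to another one by an entry of a table with a given
label. -/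
def TableEdge {n : ℕ} (τ : Fin n → Fin n → List (ℕ × List ℕ)) (a b : Fin n × List ℕ) (g : ℕ) :
    Prop :=
  ∃ t ∈ τ a.1 b.1, t.1 = g ∧ a.2 = t.2.map fun i => b.2.getD i 0

theorem primrecPred_tableEdge {n : ℕ} (τ : Fin n → Fin n → List (ℕ × List ℕ)) :
    PrimrecPred fun t : (Fin n × List ℕ) × (Fin n × List ℕ) × ℕ => TableEdge τ t.1 t.2.1 t.2.2 := by
  refine primrecPred_exists_mem
    (f := fun t : (Fin n × List ℕ) × (Fin n × List ℕ) × ℕ => τ t.1.1 t.2.1.1)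
    (p := fun t s => s.1 = t.2.2 ∧ t.1.2 = s.2.map fun i => t.2.1.2.getD i 0) ?_ ?_
  · exact (Primrec.dom_finite fun r : Fin n × Fin n => τ r.1 r.2).comp
      (Primrec.pair (Primrec.fst.comp Primrec.fst)
        (Primrec.fst.comp (Primrec.fst.comp Primrec.snd)))
  · refine PrimrecPred.and
      (Primrec.eq.comp (Primrec.fst.comp Primrec.snd)
        (Primrec.snd.comp (Primrec.snd.comp Primrec.fst)))
      (Primrec.eq.comp (Primrec.snd.comp (Primrec.fst.comp Primrec.fst))
        (Primrec.list_map (Primrec.snd.comp Primrec.snd) ?_))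
    exact (Primrec.list_getD 0).comp (Primrec.snd.comp (Primrec.fst.comp (Primrec.snd.comp
      (Primrec.fst.comp Primrec.fst)))) Primrec.snd

/-- Labelled morphisms between finitely many objects act on encoded morphisms by a finite table. -/
theorem exists_table (hC : ∀ X Y : C, Finite (X ⟶ Y)) (hG : G.incl.IsDense) {n : ℕ}
    {N : Fin n → C} (d : ∀ r, ObjectCode ν (N r)) {Λ : List ℕ}
    {Q : ∀ r r', (N r ⟶ N r') → ℕ → Prop} (hQ : ∀ r r' k g, Q r r' k g → g ∈ Λ) :
    ∃ τ : Fin n → Fin n → List (ℕ × List ℕ), ∀ {X : C} (c : ObjectCode ν X) (r r' : Fin n)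
      (h : N r ⟶ X) (h' : N r' ⟶ X) (g : ℕ),
        TableEdge τ (r, (d r).encode c h) (r', (d r').encode c h') g ↔
          ∃ k : N r ⟶ N r', k ≫ h' = h ∧ Q r r' k g := by
  have hfin (r r' : Fin n) :
      {t : ℕ × List ℕ | ∃ k : N r ⟶ N r', Q r r' k t.1 ∧ (d r).encode (d r') k = t.2}.Finite := by
    have := hC (N r) (N r')
    refine ((List.finite_toSet Λ).prod (Set.finite_range ((d r).encode (d r')))).subset ?_
    rintro t ⟨k, hk, ht⟩
    exact ⟨hQ _ _ _ _ hk, k, ht⟩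
  refine ⟨fun r r' => (hfin r r').toFinset.toList, fun c r r' h h' g => ?_⟩
  simp only [TableEdge, Finset.mem_toList, Set.Finite.mem_toFinset, Set.mem_ofPred_eq]
  constructor
  · rintro ⟨t, ⟨k, hk, ht⟩, rfl, he⟩
    refine ⟨k, ?_, hk⟩
    -- An equation `k ≫ h' = h` can be tested on encodings, which is why one table serves all `X`.
    apply (d r).encode_injective c hG
    rw [(d r).encode_comp (d r') c, ht, he]
  · rintro ⟨k, rfl, hk⟩
    exact ⟨(g, (d r).encode (d r') k), ⟨k, hk, rfl⟩, rfl, (d r).encode_comp (d r') c k h'⟩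

/-- All pairs of an index and a homomorphism from the graph with this index. -/
noncomputable def indexedHoms {n : ℕ} (d : Fin n → DiagramCode) (c : DiagramCode) :
    List (Fin n × List ℕ) :=
  (List.finRange n).flatMap fun r => (graphHoms (d r) c).map fun l => (r, l)

theorem mem_indexedHoms {n : ℕ} {d : Fin n → DiagramCode} {c : DiagramCode}
    {a : Fin n × List ℕ} : a ∈ indexedHoms d c ↔ IsGraphHom (d a.1) c a.2 := by
  simp only [indexedHoms, List.mem_flatMap, List.mem_map, mem_graphHoms]
  constructor
  · rintro ⟨r, -, l, h, rfl⟩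
    exact h
  · intro h
    exact ⟨a.1, List.mem_finRange _, a.2, h, rfl⟩

theorem primrec_indexedHoms {n : ℕ} (d : Fin n → DiagramCode) : Primrec (indexedHoms d) := by
  refine Primrec.list_flatMap (Primrec.const _) (Primrec.list_map
    (primrec_graphHoms.comp ((Primrec.dom_finite d).comp Primrec.snd) Primrec.fst) ?_)
  exact Primrec.pair (Primrec.snd.comp Primrec.fst) Primrec.snd

end Tables

namespace CategoricalGandyMachine

variable {C : Type u} [Category.{v} C] {U : C ⥤ C} {M : CategoricalGandyMachine U} {G : Subcat C}

/-! ### Triangles and the elements of the update. -/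

section Elements

variable {X : C}

theorem triangleMk_surjective (T : M.Triangles G X) : ∃ P h, M.triangleMk P h = T :=
  ⟨T.left, T.hom, T.eq_mk.symm⟩

theorem eq_of_triangleMk_eq {P : M.Rule G} {h h' : P.nbhd ⟶ X}
    (w : M.triangleMk P h = M.triangleMk P h') : h = h' :=
  eq_of_heq (Comma.mk.inj w).2.2

theorem exists_triangleHom_iff {ν : Numbering G} {P Q : M.Rule G} {h : P.nbhd ⟶ X}
    {h' : Q.nbhd ⟶ X} {g : ℕ} :
    (∃ φ : M.triangleMk P h ⟶ M.triangleMk Q h', ν.hom ((M.diagram G X).map φ) = g) ↔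
      ∃ k : P.nbhd ⟶ Q.nbhd, k ≫ h' = h ∧
        ∃ f : Rule.Hom P Q, f.nbhd = k ∧ ν.hom f.shape = g := by
  constructor
  · rintro ⟨φ, hφ⟩
    exact ⟨_, CostructuredArrow.w φ, φ.left, rfl, hφ⟩
  · rintro ⟨_, hk, f, rfl, hg⟩
    exact ⟨CostructuredArrow.homMk (f : P ⟶ Q) hk, hg⟩

/-- The occurrence of the shape of `P` in the update of its neighbourhood is sent to that of `Q`. -/
def MapsOcc (P Q : M.Rule G) (k : P.nbhd ⟶ Q.nbhd) : Prop :=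
  CostructuredArrow.mk (S := G.incl) (P.occ ≫ U.map k) = CostructuredArrow.mk Q.occ

/-- The occurrence of the shape of `P` in the update of its neighbourhood is sent to the restriction
of that of `Q` along a morphism of shapes with label `g`. -/
def RestrictsOcc (ν : Numbering G) (P Q : M.Rule G) (k : P.nbhd ⟶ Q.nbhd) (g : ℕ) : Prop :=
  ∃ b : P.shape ⟶ Q.shape, P.occ ≫ U.map k = G.incl.map b ≫ Q.occ ∧ ν.hom b = g

theorem triangleElement_eq_of_mapsOcc {P Q : M.Rule G} {h : P.nbhd ⟶ X} {h' : Q.nbhd ⟶ X}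
    {k : P.nbhd ⟶ Q.nbhd} (hk : k ≫ h' = h) (hocc : MapsOcc P Q k) :
    M.triangleElement G (M.triangleMk P h) = M.triangleElement G (M.triangleMk Q h') := by
  subst hk
  have h1 := congrArg (CostructuredArrow.map (U.map h')).obj hocc
  have h2 : (P.occ ≫ U.map k) ≫ U.map h' = P.occ ≫ U.map (k ≫ h') := by
    rw [U.map_comp, Category.assoc]
  exact (congrArg (fun a => CostructuredArrow.mk (S := G.incl) (Y := P.shape) a) h2).symm.trans h1

theorem exists_hom_triangleElement {ν : Numbering G} {P Q : M.Rule G} {h : P.nbhd ⟶ X}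
    {h' : Q.nbhd ⟶ X} {k : P.nbhd ⟶ Q.nbhd} {g : ℕ} (hk : k ≫ h' = h)
    (hocc : RestrictsOcc ν P Q k g) :
    ∃ φ : M.triangleElement G (M.triangleMk P h) ⟶ M.triangleElement G (M.triangleMk Q h'),
      ν.hom ((standardDiagram G (U.obj X)).map φ) = g := by
  subst hk
  obtain ⟨b, hb, rfl⟩ := hocc
  have w : G.incl.map b ≫ (Q.occ ≫ U.map h') = P.occ ≫ U.map (k ≫ h') := by
    rw [U.map_comp, ← Category.assoc, ← Category.assoc, hb]
  exact ⟨CostructuredArrow.homMk b w, rfl⟩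

/-- Every element of `U X` is the element of a triangle that maps to all other triangles compatible
with it. -/
theorem exists_initial_triangle (S : CostructuredArrow G.incl (U.obj X)) :
    ∃ (P : M.Rule G) (h : P.nbhd ⟶ X), M.triangleElement G (M.triangleMk P h) = S ∧
      (∀ (Q : M.Rule G) (h' : Q.nbhd ⟶ X), M.triangleElement G (M.triangleMk Q h') = S →
        ∃ k, k ≫ h' = h ∧ MapsOcc P Q k) ∧
      ∀ (ν : Numbering G) (Q : M.Rule G) (h' : Q.nbhd ⟶ X)
        (φ : S ⟶ M.triangleElement G (M.triangleMk Q h')),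
        ∃ k, k ≫ h' = h ∧
          RestrictsOcc ν P Q k (ν.hom ((standardDiagram G (U.obj X)).map φ)) := by
  refine ⟨M.causalRule G S.left S.hom, M.causalHom S.hom, M.triangleElement_causalTriangle G X S,
    ?_, ?_⟩
  · rintro Q h' rfl
    obtain ⟨k, hk, hk'⟩ := M.exists_factor (a := Q.occ ≫ U.map h') Q.occ h' rfl
    exact ⟨k, hk', congrArg (fun a => CostructuredArrow.mk (S := G.incl) (Y := Q.shape) a) hk⟩
  · intro ν Q h' φ
    have w : (G.incl.map φ.left ≫ Q.occ) ≫ U.map h' = S.hom :=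
      (Category.assoc _ _ _).trans (CostructuredArrow.w φ)
    obtain ⟨k, hk, hk'⟩ := M.exists_factor (a := S.hom) (G.incl.map φ.left ≫ Q.occ) h' w
    exact ⟨k, hk', φ.left, hk, rfl⟩

end Elements

/-! ### Evaluation of the machine on codes. -/

section Evaluation

variable {ν : Numbering G} {n : ℕ} (ρ : Fin n ≃ M.Rule G)
  (d : ∀ r, ObjectCode ν (ρ r).nbhd)

theorem exists_index_triangleMk {X : C} (T : M.Triangles G X) :
    ∃ (r : Fin n) (h : (ρ r).nbhd ⟶ X), M.triangleMk (ρ r) h = T := by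
  obtain ⟨P, h, rfl⟩ := triangleMk_surjective T
  obtain ⟨r, rfl⟩ := ρ.surjective P
  exact ⟨r, h, rfl⟩

theorem mk_mem_indexedHoms {X : C} (c : ObjectCode ν X) (r : Fin n) (h : (ρ r).nbhd ⟶ X) :
    (r, (d r).encode c h) ∈ indexedHoms (fun r => (d r).code) c.code :=
  mem_indexedHoms.2 ((d r).isGraphHom_encode c h)

theorem exists_eq_encode (hG : G.incl.IsDense) {X : C} (c : ObjectCode ν X)
    {a : Fin n × List ℕ} (ha : a ∈ indexedHoms (fun r => (d r).code) c.code) :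
    ∃ (r : Fin n) (h : (ρ r).nbhd ⟶ X), a = (r, (d r).encode c h) := by
  obtain ⟨h, hh⟩ := (d a.1).exists_encode_eq c hG (mem_indexedHoms.1 ha)
  exact ⟨a.1, h, by rw [hh]⟩

theorem isPresentation_diagram (hG : G.incl.IsDense) {X : C} (c : ObjectCode ν X)
    {edge : Fin n × List ℕ → Fin n × List ℕ → ℕ → Prop}
    (hedge : ∀ (r r' : Fin n) (h : (ρ r).nbhd ⟶ X) (h' : (ρ r').nbhd ⟶ X) (g : ℕ),
      edge (r, (d r).encode c h) (r', (d r').encode c h') g ↔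
        ∃ k, k ≫ h' = h ∧ ∃ f : Rule.Hom (ρ r) (ρ r'), f.nbhd = k ∧ ν.hom f.shape = g) :
    IsPresentation ν (M.diagram G X) (indexedHoms (fun r => (d r).code) c.code)
      (fun a => ν.obj (ρ a.1).shape) Eq edge
      (fun a T => ∃ (r : Fin n) (h : (ρ r).nbhd ⟶ X),
        a = (r, (d r).encode c h) ∧ T = M.triangleMk (ρ r) h) where
  total a ha := by
    obtain ⟨r, h, rfl⟩ := exists_eq_encode ρ d hG c ha
    exact ⟨_, r, h, rfl, rfl⟩
  surjective T := by
    obtain ⟨r, h, rfl⟩ := exists_index_triangleMk ρ T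
    exact ⟨_, mk_mem_indexedHoms ρ d c r h, r, h, rfl, rfl⟩
  label_eq := by
    rintro _ _ ⟨r, h, rfl, rfl⟩
    rfl
  rel_iff := by
    rintro _ _ _ _ - - ⟨r, h, rfl, rfl⟩ ⟨r', h', rfl, rfl⟩
    constructor
    · intro heq
      obtain ⟨rfl, hl⟩ := Prod.mk.inj heq
      rw [(d r).encode_injective c hG hl]
    · intro heq
      have hr : r = r' := ρ.injective (congrArg Comma.left heq)
      subst hr
      rw [eq_of_triangleMk_eq heq]
  edge_iff := by
    rintro _ _ _ _ g - - ⟨r, h, rfl, rfl⟩ ⟨r', h', rfl, rfl⟩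
    rw [hedge, exists_triangleHom_iff]

/-- Two triangles with the same element both receive a morphism from its minimal triangle, so one
intermediate `e` suffices and no transitive closure is needed. Likewise, an edge out of an element
is visible on its minimal triangle. Conversely, `same` and `edge` are sound because composing with
`U.map h'` preserves the equations between occurrences. -/
theorem isPresentation_standardDiagram (hG : G.incl.IsDense) {X : C} (c : ObjectCode ν X)
    {same : Fin n × List ℕ → Fin n × List ℕ → Prop}
    {edge : Fin n × List ℕ → Fin n × List ℕ → ℕ → Prop}
    (hsame : ∀ (r r' : Fin n) (h : (ρ r).nbhd ⟶ X) (h' : (ρ r').nbhd ⟶ X),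
      same (r, (d r).encode c h) (r', (d r').encode c h') ↔
        ∃ k, k ≫ h' = h ∧ MapsOcc (ρ r) (ρ r') k)
    (hedge : ∀ (r r' : Fin n) (h : (ρ r).nbhd ⟶ X) (h' : (ρ r').nbhd ⟶ X) (g : ℕ),
      edge (r, (d r).encode c h) (r', (d r').encode c h') g ↔
        ∃ k, k ≫ h' = h ∧ RestrictsOcc ν (ρ r) (ρ r') k g) :
    IsPresentation ν (standardDiagram G (U.obj X)) (indexedHoms (fun r => (d r).code) c.code)
      (fun a => ν.obj (ρ a.1).shape)
      (fun a b => ∃ e ∈ indexedHoms (fun r => (d r).code) c.code, same e a ∧ same e b)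
      (fun a b g => ∃ e ∈ indexedHoms (fun r => (d r).code) c.code, same e a ∧ edge e b g)
      (fun a S => ∃ (r : Fin n) (h : (ρ r).nbhd ⟶ X),
        a = (r, (d r).encode c h) ∧ S = M.triangleElement G (M.triangleMk (ρ r) h)) where
  total a ha := by
    obtain ⟨r, h, rfl⟩ := exists_eq_encode ρ d hG c ha
    exact ⟨_, r, h, rfl, rfl⟩
  surjective S := by
    obtain ⟨P, h, rfl, -⟩ := exists_initial_triangle (M := M) S
    obtain ⟨r, rfl⟩ := ρ.surjective P
    exact ⟨_, mk_mem_indexedHoms ρ d c r h, r, h, rfl, rfl⟩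
  label_eq := by
    rintro _ _ ⟨r, h, rfl, rfl⟩
    rfl
  rel_iff := by
    rintro _ _ _ _ - - ⟨r, h, rfl, rfl⟩ ⟨r', h', rfl, rfl⟩
    constructor
    · rintro ⟨e, he, h1, h2⟩
      obtain ⟨s, m, rfl⟩ := exists_eq_encode ρ d hG c he
      obtain ⟨k, hk, hocc⟩ := (hsame _ _ _ _).1 h1
      obtain ⟨k', hk', hocc'⟩ := (hsame _ _ _ _).1 h2
      rw [← triangleElement_eq_of_mapsOcc hk hocc, ← triangleElement_eq_of_mapsOcc hk' hocc']
    · intro heq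
      obtain ⟨P, m, -, hP, -⟩ :=
        exists_initial_triangle (M.triangleElement G (M.triangleMk (ρ r) h))
      obtain ⟨s, rfl⟩ := ρ.surjective P
      exact ⟨_, mk_mem_indexedHoms ρ d c s m, (hsame _ _ _ _).2 (hP _ _ rfl),
        (hsame _ _ _ _).2 (hP _ _ heq.symm)⟩
  edge_iff := by
    rintro _ _ _ _ g - - ⟨r, h, rfl, rfl⟩ ⟨r', h', rfl, rfl⟩
    constructor
    · rintro ⟨e, he, h1, h2⟩
      obtain ⟨s, m, rfl⟩ := exists_eq_encode ρ d hG c he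
      obtain ⟨k, hk, hocc⟩ := (hsame _ _ _ _).1 h1
      obtain ⟨k', hk', hocc'⟩ := (hedge _ _ _ _ _).1 h2
      rw [← triangleElement_eq_of_mapsOcc hk hocc]
      exact exists_hom_triangleElement hk' hocc'
    · rintro ⟨φ, rfl⟩
      obtain ⟨P, m, -, hP, hP'⟩ :=
        exists_initial_triangle (M.triangleElement G (M.triangleMk (ρ r) h))
      obtain ⟨s, rfl⟩ := ρ.surjective P
      exact ⟨_, mk_mem_indexedHoms ρ d c s m, (hsame _ _ _ _).2 (hP _ _ rfl),
        (hedge _ _ _ _ _).2 (hP' ν _ _ φ)⟩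

end Evaluation

theorem exists_computable_codes (M : CategoricalGandyMachine U) (hG : G.IsFinite)
    (hdense : G.incl.IsDense) (ν : Numbering G) :
    ∃ f g : DiagramCode → DiagramCode, Computable f ∧ Computable g ∧
      ∀ (X : C) (c : DiagramCode), IsCode ν (standardDiagram G X) c →
        IsCode ν (M.diagram G X) (f c) ∧ IsCode ν (standardDiagram G (U.obj X)) (g c) := by
  have := hG.finite_carrier
  have := M.finite_rule G hG
  obtain ⟨n, ⟨ρ'⟩⟩ := Finite.exists_equiv_fin (M.Rule G)
  let ρ := ρ'.symm
  obtain ⟨Λ, hΛ⟩ := ν.exists_labels hG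
  have hcode (X : C) : Nonempty (ObjectCode ν X) := by
    have := finite_costructuredArrow M.locallyFinite G.incl X
    obtain ⟨c, x, hx⟩ := exists_isCode ν
      (finite_costructuredArrow_hom hG.finite_hom G.incl X) (standardDiagram G X)
    exact ⟨c, x, hx⟩
  -- These codes are chosen nonconstructively, but there are finitely many and none depends on the
  -- input, so they are constants of the algorithm. The same holds for the tables below.
  let d (r : Fin n) : ObjectCode ν (ρ r).nbhd := (hcode _).some
  obtain ⟨τ, hτ⟩ := exists_table M.locallyFinite hdense d (Λ := Λ)
    (Q := fun r r' k g => ∃ f : Rule.Hom (ρ r) (ρ r'), f.nbhd = k ∧ ν.hom f.shape = g)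
    (by rintro r r' _ _ ⟨f, -, rfl⟩; exact hΛ _ _ _)
  -- Only the existence of an entry matters in this table, so `0` serves as a dummy label.
  obtain ⟨σ, hσ⟩ := exists_table M.locallyFinite hdense d (Λ := [0])
    (Q := fun r r' k g => g = 0 ∧ MapsOcc (ρ r) (ρ r') k)
    (by rintro r r' _ _ ⟨rfl, -⟩; exact List.mem_singleton_self 0)
  obtain ⟨ε, hε⟩ := exists_table M.locallyFinite hdense d (Λ := Λ)
    (Q := fun r r' k g => RestrictsOcc ν (ρ r) (ρ r') k g)
    (by rintro r r' _ _ ⟨f, -, rfl⟩; exact hΛ _ _ _)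
  let homs := indexedHoms fun r => (d r).code
  have hhoms : Primrec homs := primrec_indexedHoms _
  let label (a : Fin n × List ℕ) : ℕ := ν.obj (ρ a.1).shape
  have hlabel : Primrec label :=
    (Primrec.dom_finite fun r => ν.obj (ρ r).shape).comp Primrec.fst
  let rel (c : DiagramCode) (a b : Fin n × List ℕ) : Prop :=
    ∃ e ∈ homs c, TableEdge σ e a 0 ∧ TableEdge σ e b 0
  let edge (c : DiagramCode) (a b : Fin n × List ℕ) (g : ℕ) : Prop :=
    ∃ e ∈ homs c, TableEdge σ e a 0 ∧ TableEdge ε e b g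
  have hrel : PrimrecPred fun t : DiagramCode × (Fin n × List ℕ) × (Fin n × List ℕ) =>
      rel t.1 t.2.1 t.2.2 := by
    refine primrecPred_exists_mem
      (p := fun (t : DiagramCode × (Fin n × List ℕ) × (Fin n × List ℕ)) e =>
        TableEdge σ e t.2.1 0 ∧ TableEdge σ e t.2.2 0) (hhoms.comp Primrec.fst) ?_
    have ht := Primrec.snd.comp (Primrec.fst (α := DiagramCode × (Fin n × List ℕ) × (Fin n × List ℕ))
      (β := Fin n × List ℕ))
    exact ((primrecPred_tableEdge σ).comp
        (Primrec.pair Primrec.snd (Primrec.pair (Primrec.fst.comp ht) (Primrec.const 0)))).and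
      ((primrecPred_tableEdge σ).comp
        (Primrec.pair Primrec.snd (Primrec.pair (Primrec.snd.comp ht) (Primrec.const 0))))
  have hedge : PrimrecPred fun t : DiagramCode × (Fin n × List ℕ) × (Fin n × List ℕ) × ℕ =>
      edge t.1 t.2.1 t.2.2.1 t.2.2.2 := by
    refine primrecPred_exists_mem
      (p := fun (t : DiagramCode × (Fin n × List ℕ) × (Fin n × List ℕ) × ℕ) e =>
        TableEdge σ e t.2.1 0 ∧ TableEdge ε e t.2.2.1 t.2.2.2) (hhoms.comp Primrec.fst) ?_
    have ht := Primrec.snd.comp (Primrec.fst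
      (α := DiagramCode × (Fin n × List ℕ) × (Fin n × List ℕ) × ℕ) (β := Fin n × List ℕ))
    exact ((primrecPred_tableEdge σ).comp
        (Primrec.pair Primrec.snd (Primrec.pair (Primrec.fst.comp ht) (Primrec.const 0)))).and
      ((primrecPred_tableEdge ε).comp (Primrec.pair Primrec.snd (Primrec.snd.comp ht)))
  refine ⟨fun c => codeOf Λ (representatives Eq (homs c)) label (TableEdge τ),
    fun c => codeOf Λ (representatives (rel c) (homs c)) label (edge c),
    (primrec_codeOf Λ (primrec_representatives (rel := fun _ => Eq) hhoms
      (Primrec.eq.comp (Primrec.fst.comp Primrec.snd) (Primrec.snd.comp Primrec.snd))) hlabel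
      ((primrecPred_tableEdge τ).comp Primrec.snd)).to_comp,
    (primrec_codeOf Λ (primrec_representatives hhoms hrel) hlabel hedge).to_comp, ?_⟩
  rintro X c ⟨x, hx⟩
  let c' : ObjectCode ν X := ⟨c, x, hx⟩
  exact ⟨(isPresentation_diagram ρ d hdense c' (hτ c')).isCode hΛ,
    (isPresentation_standardDiagram ρ d hdense c' (same := fun a b => TableEdge σ a b 0)
      (fun r r' h h' => (hσ c' r r' h h' 0).trans (by simp)) (hε c')).isCode hΛ⟩

end CategoricalGandyMachine

end Gandy

theorem corollary1 {C : Type u} [Category.{v} C] {U : C ⥤ C}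
    (M : Gandy.CategoricalGandyMachine U) (G : Gandy.Subcat C) (hG : G.IsFinite)
    (hdense : G.incl.IsDense) :
    -- the precomputed data, independent of any input object, are finite
    (M.neighbourhoods G).IsFinite ∧
    Finite (M.Rule G) ∧
    (∀ P Q : M.Rule G, Finite (P ⟶ Q)) ∧
    -- `U X` is the colimit of a finite diagram of triangles on the precomputed data, with apex `X`
    (∀ X : C,
      Finite (M.Triangles G X) ∧
      (∀ S T : M.Triangles G X, Finite (S ⟶ T)) ∧
      Nonempty (IsColimit (M.cocone G X))) ∧
    -- the evaluation of `U` is Turing computable on diagrams representing objects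
    (∀ ν : Gandy.Numbering G,
      (∀ X : C, Nonempty (IsColimit (Gandy.standardCocone G X)) ∧
        ∃ c : Gandy.DiagramCode, Gandy.IsCode ν (Gandy.standardDiagram G X) c) ∧
      ∃ f g : Gandy.DiagramCode → Gandy.DiagramCode, Computable f ∧ Computable g ∧
        ∀ (X : C) (c : Gandy.DiagramCode),
          Gandy.IsCode ν (Gandy.standardDiagram G X) c →
            Gandy.IsCode ν (M.diagram G X) (f c) ∧
            Gandy.IsCode ν (Gandy.standardDiagram G (U.obj X)) (g c)) := by
  have := hG.finite_carrier
  have := M.finite_rule G hG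
  refine ⟨M.neighbourhoods_isFinite G hG, M.finite_rule G hG, M.finite_rule_hom G hG,
    fun X => ⟨Gandy.finite_costructuredArrow M.locallyFinite _ X,
      Gandy.finite_costructuredArrow_hom (M.finite_rule_hom G hG) _ X,
      M.isColimit_cocone G hdense X⟩,
    fun ν => ⟨fun X => ⟨Gandy.isColimit_standardCocone hdense X, ?_⟩,
      M.exists_computable_codes hG hdense ν⟩⟩
  have := Gandy.finite_costructuredArrow M.locallyFinite G.incl X
  exact Gandy.exists_isCode ν (Gandy.finite_costructuredArrow_hom hG.finite_hom G.incl X) _
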